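/- Let $G$ be a finite nilpotent group and let $\chi$ be a faithful irreducible complex character of $G$. Suppose that $$\chi\overline{\chi} = 1_G + m_1\alpha_1 + m_2\alpha_2,$$ where $1_G$ is the principal character, $\alpha_1,\alpha_2$ are non-principal irreducible complex characters of $G$, and $m_1,m_2$ are strictly positive integers. Then $m_1=m_2=1$ and $\chi(1)=2$. Moreover, $G/\mathbf{Z}(G)$ is isomorphic to a dihedral $2$-group, that is, to the dihedral group of order $2^{k}$ for some integer $k\ge 3$. -/

import Mathlib

/-- `χ : G → ℂ` is an irreducible complex character of `G`: the trace function of an irreducible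
representation of `G` on some `ℂⁿ` (every finite-dimensional complex representation is isomorphic
to one of this form, so nothing is lost by fixing the underlying space). -/
def IsIrrChar {G : Type*} [Group G] (χ : G → ℂ) : Prop :=
  ∃ (n : ℕ) (ρ : Representation ℂ G (Fin n → ℂ)), ρ.IsIrreducible ∧ ρ.character = χ

/-- The kernel `{g | χ g = χ 1}` of a character `χ`, as a set. -/
def charKer {G : Type*} [Group G] (χ : G → ℂ) : Set G :=
  {g | χ g = χ 1}

/-- A character is faithful if its kernel is trivial. -/
def IsFaithfulChar {G : Type*} [Group G] (χ : G → ℂ) : Prop :=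
  charKer χ = {1}

/-!
Write `Z` for the center of `G`, `H` for its second center, `a = m₁ α₁(1)` and `b = m₂ α₂(1)`, so
that `χ(1)² = 1 + a + b`. No general character theory beyond Schur's lemma is needed.

* Since `χ` is faithful and irreducible, the elements acting by scalars are those of `Z`. On `Z` one
  has `|χ| = χ(1)`, so `α₁` and `α₂` are trivial there, and by Schur's lemma they restrict to
  multiples of linear characters `μ₁`, `μ₂` of `H ⧸ Z`. If `z ∈ H` is not in `Z`, some conjugate of
  `z` is `z` times a nontrivial scalar, so `χ(z) = 0` (`character_eq_zero_of_commutator_mem`). Thus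
  `1 + a μ₁ + b μ₂` is a multiple of the regular character of `H ⧸ Z`, and comparing multiplicities
  shows that one of `μ₁`, `μ₂` is trivial (`eq_one_or_eq_one_of_vanishing_off`), say `μ₁`. Then
  `μ₂ = -1` off `Z`, so `H ⧸ Z` has order two, and `b = 1 + a`.
* As `H ⧸ Z` is the center of the nilpotent group `G ⧸ Z`, the latter is a `2`-group
  (`Group.isPGroup_of_isPGroup_center`). From `χ(1)² = 2 b` it follows that `χ(1)` and `b` are
  even and `a` is odd, so `α₁` has odd degree and is linear
  (`Representation.scalarSubgroup_eq_top_of_odd_finrank`).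
* The multiplicity of a linear constituent of `χ χ̄` is at most one, being a Fourier coefficient of
  `|χ|²` (`fourierCoeff_le_of_nonneg`). Hence `m₁ = 1`, `b = 2` and `χ(1) = 2`; also `α₂` is not
  linear, so `m₂ = 1`. Equality for `α₁` means that `χ` vanishes off `K = ker α₁`, and summing
  `|χ|² = 2 + α₂` over `K` shows that `K` has index two.
* For `g ∉ K` the `2 × 2` matrix of `g` has trace zero, so its square is a scalar and `g² ∈ Z`. So
  all elements of `G ⧸ Z` outside the index-two subgroup `K ⧸ Z` are involutions, and a `2`-group
  with this property and a center of order two inside that subgroup is dihedral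
  (`DihedralGroup.exists_mulEquiv_of_card_center_eq_two`).
-/

/-! ### Scalar elements of a representation -/

namespace Representation

variable {G V : Type*} [Group G] [AddCommGroup V] [Module ℂ V]

/-- The subgroup of elements that a representation sends to scalar operators. -/
def scalarSubgroup (ρ : Representation ℂ G V) : Subgroup G where
  carrier := {g | ∃ c : ℂ, ρ g = algebraMap ℂ (Module.End ℂ V) c}
  one_mem' := ⟨1, by simp⟩
  mul_mem' := by
    rintro g h ⟨c, hc⟩ ⟨e, he⟩
    exact ⟨c * e, by rw [map_mul, hc, he, map_mul]⟩
  inv_mem' := by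
    rintro g ⟨c, hc⟩
    have h1 : ρ g * ρ g⁻¹ = 1 := by rw [← map_mul, mul_inv_cancel, map_one]
    by_cases hc0 : c = 0
    · rw [hc, hc0, map_zero, zero_mul] at h1
      exact ⟨0, by rw [map_zero, ← one_mul (ρ g⁻¹), ← h1, zero_mul]⟩
    · refine ⟨c⁻¹, ?_⟩
      rw [← one_mul (ρ g⁻¹), ← map_one (algebraMap ℂ (Module.End ℂ V)), ← inv_mul_cancel₀ hc0,
        map_mul, mul_assoc, ← hc, h1, mul_one]

theorem mem_scalarSubgroup {ρ : Representation ℂ G V} {g : G} :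
    g ∈ ρ.scalarSubgroup ↔ ∃ c : ℂ, ρ g = algebraMap ℂ (Module.End ℂ V) c := Iff.rfl

instance normal_scalarSubgroup (ρ : Representation ℂ G V) : ρ.scalarSubgroup.Normal where
  conj_mem := by
    rintro g ⟨c, hc⟩ h
    refine ⟨c, ?_⟩
    rw [map_mul, map_mul, hc, ← Algebra.commutes, mul_assoc, ← map_mul, mul_inv_cancel, map_one,
      mul_one]

/-- Schur's lemma for a group element: if `ρ z` commutes with the image of an irreducible
representation `ρ`, then it is a scalar. -/
theorem mem_scalarSubgroup_of_commute [FiniteDimensional ℂ V] {ρ : Representation ℂ G V}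
    (hρ : ρ.IsIrreducible) {z : G} (hz : ∀ g, ρ (z * g) = ρ (g * z)) :
    z ∈ ρ.scalarSubgroup := by
  let f : IntertwiningMap ρ ρ := ⟨ρ z, fun g ↦ by
    rw [← Module.End.mul_eq_comp, ← Module.End.mul_eq_comp, ← map_mul, ← map_mul, hz]⟩
  obtain ⟨c, hc⟩ := (IsIrreducible.algebraMap_intertwiningMap_bijective_of_isAlgClosed (ρ := ρ)).2 f
  refine ⟨c, ?_⟩
  have := congrArg IntertwiningMap.toLinearMap hc
  rw [show ρ z = f.toLinearMap from rfl, ← this]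
  rfl

/-- The scalars by which a subgroup of scalar elements acts form a linear character. -/
theorem exists_hom_of_le_scalarSubgroup [Nontrivial V] {ρ : Representation ℂ G V} {H : Subgroup G}
    (hH : H ≤ ρ.scalarSubgroup) :
    ∃ μ : H →* ℂ, ∀ h : H, ρ h = algebraMap ℂ (Module.End ℂ V) (μ h) := by
  have hinj : Function.Injective (algebraMap ℂ (Module.End ℂ V)) :=
    FaithfulSMul.algebraMap_injective _ _
  choose μ hμ using fun h : H ↦ hH h.2
  refine ⟨⟨⟨μ, ?_⟩, ?_⟩, hμ⟩
  · apply hinj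
    rw [← hμ]
    simp
  · intro x y
    apply hinj
    rw [← hμ, map_mul, ← hμ, ← hμ, ← map_mul, Subgroup.coe_mul]

theorem character_of_eq_algebraMap [FiniteDimensional ℂ V] {ρ : Representation ℂ G V} {g : G}
    {c : ℂ} (h : ρ g = algebraMap ℂ (Module.End ℂ V) c) :
    ρ.character g = c * Module.finrank ℂ V := by
  rw [character, h, Algebra.algebraMap_eq_smul_one, map_smul, LinearMap.trace_one, smul_eq_mul]

/-- If `z` is not a scalar but is central modulo the scalars, then some conjugate of `ρ z` is a
multiple `c • ρ z` with `c ≠ 1`, so the trace of `ρ z` vanishes. -/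
theorem character_eq_zero_of_commutator_mem [FiniteDimensional ℂ V] {ρ : Representation ℂ G V}
    (hρ : ρ.IsIrreducible) {z : G} (hz : z ∉ ρ.scalarSubgroup)
    (hcomm : ∀ g, g * z * g⁻¹ * z⁻¹ ∈ ρ.scalarSubgroup) : ρ.character z = 0 := by
  obtain ⟨g, hg⟩ : ∃ g, ρ (z * g) ≠ ρ (g * z) := by
    by_contra! h
    exact hz (mem_scalarSubgroup_of_commute hρ h)
  obtain ⟨c, hc⟩ := hcomm g
  have hconj : ρ (g * z * g⁻¹) = c • ρ z := by
    rw [Algebra.smul_def, ← hc, ← map_mul, inv_mul_cancel_right]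
  have hc1 : c ≠ 1 := by
    rintro rfl
    apply hg
    rw [one_smul] at hconj
    rw [map_mul, ← hconj, ← map_mul, inv_mul_cancel_right]
  have h1 : ρ.character z = c * ρ.character z := by
    conv_lhs => rw [← char_conj ρ z g, character, hconj, map_smul, smul_eq_mul, ← character]
  have h2 : (1 - c) * ρ.character z = 0 := by linear_combination h1
  exact (mul_eq_zero.mp h2).resolve_left (sub_ne_zero.mpr hc1.symm)

theorem IsIrreducible.nontrivial_space {ρ : Representation ℂ G V} (hρ : ρ.IsIrreducible) :
    Nontrivial V := by
  by_contra h
  rw [not_nontrivial_iff_subsingleton] at h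
  refine hρ.exists_pair_ne.elim fun a ⟨b, hab⟩ ↦ hab ?_
  ext v
  rw [Subsingleton.elim v 0]
  exact iff_of_true a.toSubmodule.zero_mem b.toSubmodule.zero_mem

/-- An irreducible representation by scalars has degree one. -/
theorem finrank_eq_one_of_scalarSubgroup_eq_top {ρ : Representation ℂ G V}
    (hρ : ρ.IsIrreducible) (h : ρ.scalarSubgroup = ⊤) : Module.finrank ℂ V = 1 := by
  have := hρ.nontrivial_space
  obtain ⟨v, hv⟩ := exists_ne (0 : V)
  let W : Subrepresentation ρ := ⟨Submodule.span ℂ {v}, fun g w hw ↦ by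
    obtain ⟨c, hc⟩ : g ∈ ρ.scalarSubgroup := h ▸ Subgroup.mem_top g
    rw [hc, Module.algebraMap_end_apply]
    exact Submodule.smul_mem _ _ hw⟩
  have hW : W = ⊤ := (hρ.eq_bot_or_eq_top W).resolve_left fun hb ↦ hv <| by
    have h1 : v ∈ W.toSubmodule := Submodule.mem_span_singleton_self v
    rw [hb] at h1
    exact (Submodule.mem_bot ℂ).mp h1
  have hW' : Submodule.span ℂ {v} = ⊤ := congrArg Subrepresentation.toSubmodule hW
  rw [← finrank_top ℂ V, ← hW', finrank_span_singleton hv]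

end Representation

/-- An operator of trace zero whose square is a nonzero scalar `s ^ 2` has eigenvalues `s` and `-s`
with equal multiplicity. -/
theorem even_finrank_of_trace_eq_zero {V : Type*} [AddCommGroup V] [Module ℂ V]
    [FiniteDimensional ℂ V] {T : Module.End ℂ V} {c : ℂ} (hc : c ≠ 0)
    (hT : T * T = algebraMap ℂ (Module.End ℂ V) c) (htr : LinearMap.trace ℂ V T = 0) :
    Even (Module.finrank ℂ V) := by
  obtain ⟨s, rfl⟩ := IsAlgClosed.exists_eq_mul_self c
  have hs : s ≠ 0 := fun h ↦ hc (by simp [h])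
  -- the projection onto the `s`-eigenspace, whose trace is half the dimension
  let P : Module.End ℂ V := (2⁻¹ : ℂ) • (1 + s⁻¹ • T)
  have hP : IsIdempotentElem P := by
    have h1 : (s⁻¹ • T) * (s⁻¹ • T) = 1 := by
      rw [smul_mul_smul_comm, hT, Algebra.algebraMap_eq_smul_one, smul_smul]
      field_simp
      simp
    simp only [IsIdempotentElem, P]
    rw [smul_mul_smul_comm]
    simp only [mul_add, add_mul, h1, mul_one, one_mul]
    module
  have h2 := (LinearMap.IsIdempotentElem.isProj_range P hP).trace
  simp only [P, map_smul, map_add, htr, LinearMap.trace_one, smul_eq_mul,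
    mul_zero, add_zero] at h2
  rw [even_iff_two_dvd]
  refine ⟨Module.finrank ℂ (LinearMap.range P), ?_⟩
  have h3 : (Module.finrank ℂ V : ℂ) = 2 * Module.finrank ℂ (LinearMap.range P) := by
    rw [← h2]; ring
  exact_mod_cast h3

namespace Representation

/-- If every element has a power of two power that is a scalar, an irreducible representation of
odd degree is linear. Otherwise some `z` outside the scalar subgroup is central of order two modulo
it; then `ρ z` has trace zero and a scalar square, and the degree is even. -/
theorem scalarSubgroup_eq_top_of_odd_finrank {G V : Type*} [Group G] [Finite G]
    [Group.IsNilpotent G] [AddCommGroup V] [Module ℂ V] [FiniteDimensional ℂ V]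
    {ρ : Representation ℂ G V} (hρ : ρ.IsIrreducible)
    (hpow : ∀ g, ∃ k, g ^ 2 ^ k ∈ ρ.scalarSubgroup) (hodd : Odd (Module.finrank ℂ V)) :
    ρ.scalarSubgroup = ⊤ := by
  by_contra hne
  have hnt : Nontrivial (G ⧸ ρ.scalarSubgroup) := by
    rw [← not_subsingleton_iff_nontrivial]
    exact fun h ↦ hne (QuotientGroup.subgroup_eq_top_of_subsingleton _ h)
  obtain ⟨⟨x, hxc⟩, hx1⟩ := Subgroup.ne_bot_iff_exists_ne_one.mp
    (Group.IsNilpotent.center_ne_bot (G := G ⧸ ρ.scalarSubgroup))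
  have hx1 : x ≠ 1 := fun h ↦ hx1 (Subtype.ext h)
  have hex : ∃ k, x ^ 2 ^ k = 1 := by
    obtain ⟨g, rfl⟩ := QuotientGroup.mk_surjective x
    obtain ⟨k, hk⟩ := hpow g
    exact ⟨k, by rwa [← QuotientGroup.mk_pow, QuotientGroup.eq_one_iff]⟩
  -- a power of `x` is a central involution
  obtain ⟨y, hyc, hy1, hy2⟩ : ∃ y ∈ Subgroup.center (G ⧸ ρ.scalarSubgroup), y ≠ 1 ∧ y * y = 1 := by
    classical
    obtain ⟨k, hk⟩ : ∃ k, Nat.find hex = k + 1 := Nat.exists_eq_succ_of_ne_zero fun h0 ↦ hx1 <| by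
      simpa [h0] using Nat.find_spec hex
    refine ⟨x ^ 2 ^ k, Subgroup.pow_mem _ hxc _, Nat.find_min hex (by omega), ?_⟩
    rw [← pow_add, ← two_mul, ← pow_succ', ← hk]
    exact Nat.find_spec hex
  obtain ⟨z, rfl⟩ := QuotientGroup.mk_surjective y
  have hz : z ∉ ρ.scalarSubgroup := fun h ↦ hy1 ((QuotientGroup.eq_one_iff z).mpr h)
  have htr : ρ.character z = 0 := character_eq_zero_of_commutator_mem hρ hz fun g ↦ by
    rw [← QuotientGroup.eq_one_iff]
    simp only [QuotientGroup.mk_mul, QuotientGroup.mk_inv]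
    rw [Subgroup.mem_center_iff.mp hyc, mul_inv_cancel_right, mul_inv_cancel]
  obtain ⟨c, hc⟩ : z * z ∈ ρ.scalarSubgroup := by
    rw [← QuotientGroup.eq_one_iff]
    exact hy2
  have hV : Nontrivial V := Module.nontrivial_of_finrank_pos (R := ℂ) hodd.pos
  have hc0 : c ≠ 0 := by
    rintro rfl
    have h1 : ρ (z * z) * ρ (z * z)⁻¹ = 1 := by rw [← map_mul, mul_inv_cancel, map_one]
    rw [hc, map_zero, zero_mul] at h1
    exact zero_ne_one h1
  exact Nat.not_even_iff_odd.mpr hodd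
    (even_finrank_of_trace_eq_zero hc0 (by rw [← map_mul, hc]) htr)

end Representation

/-! ### Nilpotent groups and dihedral `2`-groups -/

namespace Group

/-- A nontrivial normal subgroup of a nilpotent group contains a nontrivial central element, found
where the subgroup first meets the upper central series. -/
theorem exists_mem_center_of_normal_ne_bot {Q : Type*} [Group Q] [IsNilpotent Q] {N : Subgroup Q}
    [N.Normal] (hN : N ≠ ⊥) : ∃ x ∈ N, x ∈ Subgroup.center Q ∧ x ≠ 1 := by
  classical
  have hex : ∃ n, ∃ x ∈ N, x ∈ Subgroup.upperCentralSeries Q n ∧ x ≠ 1 := by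
    obtain ⟨n, hn⟩ := IsNilpotent.nilpotent Q
    obtain ⟨x, hx⟩ := Subgroup.ne_bot_iff_exists_ne_one.mp hN
    exact ⟨n, x, x.2, by simp [hn], fun h ↦ hx (Subtype.ext h)⟩
  obtain ⟨x, hxN, hx, hx1⟩ := Nat.find_spec hex
  obtain ⟨n, hn⟩ : ∃ n, Nat.find hex = n + 1 := Nat.exists_eq_succ_of_ne_zero fun h0 ↦ hx1 <| by
    rw [h0, Subgroup.upperCentralSeries_zero] at hx
    exact Subgroup.mem_bot.mp hx
  refine ⟨x, hxN, Subgroup.mem_center_iff.mpr fun g ↦ ?_, hx1⟩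
  rw [hn, Subgroup.mem_upperCentralSeries_succ_iff] at hx
  have h1 : x * g * x⁻¹ * g⁻¹ ∈ N := by
    rw [mul_assoc, mul_assoc]
    refine N.mul_mem hxN ?_
    rw [← mul_assoc]
    exact ‹N.Normal›.conj_mem _ (N.inv_mem hxN) g
  by_contra hne
  refine Nat.find_min hex (show n < Nat.find hex by omega) ⟨_, h1, hx g, fun h ↦ hne ?_⟩
  rw [mul_inv_eq_one, mul_inv_eq_iff_eq_mul] at h
  exact h.symm

/-- A finite nilpotent group whose center is a `p`-group is a `p`-group. -/
theorem isPGroup_of_isPGroup_center {Q : Type*} [Group Q] [Finite Q] [IsNilpotent Q] {p : ℕ}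
    [Fact p.Prime] (h : IsPGroup p (Subgroup.center Q)) : IsPGroup p Q := by
  refine IsPGroup.of_card (Nat.eq_prime_pow_of_unique_prime_dvd Nat.card_pos.ne' fun {q} hq hd ↦ ?_)
  have : Fact q.Prime := ⟨hq⟩
  obtain ⟨P⟩ := (inferInstance : Nonempty (Sylow q Q))
  obtain ⟨x, hxP, hxc, hx1⟩ := exists_mem_center_of_normal_ne_bot (P.ne_bot_of_dvd_card hd)
  obtain ⟨i, hi⟩ := P.isPGroup' ⟨x, hxP⟩
  obtain ⟨j, hj⟩ := h ⟨x, hxc⟩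
  have hi' : orderOf x ∣ q ^ i := orderOf_dvd_of_pow_eq_one (congrArg Subtype.val hi)
  have hj' : orderOf x ∣ p ^ j := orderOf_dvd_of_pow_eq_one (congrArg Subtype.val hj)
  by_contra hne
  exact hx1 (orderOf_eq_one_iff.mp (Nat.eq_one_of_dvd_coprimes
    (Nat.coprime_pow_primes i j hq Fact.out hne) hi' hj'))

end Group

/-- A finite abelian `2`-group with at most one involution is cyclic: it is generated by any
element `a` of maximal order. -/
theorem IsPGroup.isCyclic_of_unique_involution {A : Type*} [CommGroup A] [Finite A]
    (hA : IsPGroup 2 A)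
    (hinv : ∀ x y : A, x ^ 2 = 1 → y ^ 2 = 1 → x ≠ 1 → y ≠ 1 → x = y) : IsCyclic A := by
  obtain ⟨a, ha⟩ := Monoid.exists_orderOf_eq_exponent (Monoid.ExponentExists.of_finite (G := A))
  obtain ⟨m, hm⟩ := (IsPGroup.iff_orderOf.mp hA) a
  have hexp : ∀ b : A, b ^ 2 ^ m = 1 := fun b ↦ by
    rw [← hm, ha, Monoid.pow_exponent_eq_one]
  suffices h : ∀ k, ∀ b : A, b ^ 2 ^ k = 1 → b ∈ Subgroup.zpowers a from
    ⟨a, fun b ↦ h m b (hexp b)⟩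
  intro k
  induction k with
  | zero =>
    intro b hb
    rw [show b = 1 by simpa using hb]
    exact Subgroup.one_mem _
  | succ k ih =>
    intro b hb
    rcases Nat.eq_zero_or_pos m with rfl | hm0
    · rw [show b = 1 by simpa using hexp b]
      exact Subgroup.one_mem _
    obtain ⟨l, rfl⟩ : ∃ l, m = l + 1 := Nat.exists_eq_succ_of_ne_zero hm0.ne'
    obtain ⟨i, hi⟩ := Subgroup.mem_zpowers_iff.mp
      (ih (b ^ 2) (by rw [← pow_mul, ← pow_succ', hb]))
    -- an odd `i` would make the order of `b` exceed that of `a`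
    obtain ⟨j, rfl⟩ : (2 : ℤ) ∣ i := by
      have h1 : a ^ (i * 2 ^ l) = 1 := by
        rw [zpow_mul, hi, ← hexp b, pow_succ' 2 l, pow_mul]
        norm_cast
      have h2 := orderOf_dvd_iff_zpow_eq_one.mpr h1
      rw [hm, pow_succ'] at h2
      push_cast at h2
      exact Int.dvd_of_mul_dvd_mul_right (by positivity) h2
    have hc : (b * (a ^ j)⁻¹) ^ 2 = 1 := by
      rw [mul_pow, ← hi, zpow_mul', inv_pow, zpow_ofNat]
      simp
    by_cases hb1 : b * (a ^ j)⁻¹ = 1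
    · exact Subgroup.mem_zpowers_iff.mpr ⟨j, (mul_inv_eq_one.mp hb1).symm⟩
    have hal : a ^ 2 ^ l ≠ 1 := fun h ↦ by
      have := Nat.le_of_dvd (by positivity) (orderOf_dvd_of_pow_eq_one h)
      rw [hm, pow_succ] at this
      have : 0 < 2 ^ l := by positivity
      omega
    have h3 := hinv _ (a ^ 2 ^ l) hc (by rw [← pow_mul, ← pow_succ, hexp]) hb1 hal
    rw [mul_inv_eq_iff_eq_mul] at h3
    rw [h3]
    exact Subgroup.mul_mem _ (Subgroup.npow_mem_zpowers a _) (Subgroup.zpow_mem_zpowers a _)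

namespace DihedralGroup

/-- A group is dihedral if it has a cyclic subgroup `A` of index two and an involution outside `A`
that inverts `A`. -/
theorem nonempty_mulEquiv_of_inverting_involution {Q : Type*} [Group Q] {N : ℕ} {A : Subgroup Q}
    (hA : A.index = 2) (φ : Multiplicative (ZMod N) ≃* A) {t : Q} (ht : t ∉ A) (ht2 : t * t = 1)
    (hinv : ∀ k ∈ A, t * k * t = k⁻¹) : Nonempty (Q ≃* DihedralGroup N) := by
  let ψ : ZMod N → Q := fun i ↦ φ (Multiplicative.ofAdd i)
  have hψA : ∀ i, ψ i ∈ A := fun i ↦ (φ _).2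
  have hadd : ∀ i j, ψ (i + j) = ψ i * ψ j := fun i j ↦ by simp [ψ, ofAdd_add]
  have hsub : ∀ i j, ψ (j - i) = (ψ i)⁻¹ * ψ j := fun i j ↦ by
    rw [eq_inv_mul_iff_mul_eq, ← hadd, add_sub_cancel]
  have hψinj : Function.Injective ψ := fun i j h ↦
    Multiplicative.ofAdd.injective (φ.injective (Subtype.ext h))
  have hψsurj : ∀ g ∈ A, ∃ i, ψ i = g := fun g hg ↦
    ⟨Multiplicative.toAdd (φ.symm ⟨g, hg⟩), by simp [ψ]⟩
  have htmul : ∀ g ∉ A, t * g ∈ A := fun g hg ↦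
    (Subgroup.mul_mem_iff_of_index_two hA).mpr (iff_of_false ht hg)
  have hmem : ∀ i, t * ψ i ∉ A := fun i h ↦ ht ((A.mul_mem_cancel_right (hψA i)).mp h)
  have hswap : ∀ i, ψ i * t = t * (ψ i)⁻¹ := fun i ↦ by
    rw [← hinv _ (hψA i), ← mul_assoc, ← mul_assoc, ht2, one_mul]
  let f : DihedralGroup N → Q
    | r i => ψ i
    | sr i => t * ψ i
  have hf : ∀ x y, f (x * y) = f x * f y := by
    rintro (i | i) (j | j)
    · exact hadd i j
    · change t * ψ (j - i) = ψ i * (t * ψ j)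
      rw [hsub, ← mul_assoc, ← mul_assoc, hswap]
    · change t * ψ (i + j) = t * ψ i * ψ j
      rw [hadd, mul_assoc]
    · change ψ (j - i) = t * ψ i * (t * ψ j)
      rw [hsub, ← mul_assoc, hinv _ (hψA i)]
  refine ⟨(MulEquiv.ofBijective (MonoidHom.mk' f hf) ⟨?_, ?_⟩).symm⟩
  · rintro (i | i) (j | j) h
    · exact congrArg r (hψinj h)
    · exact (hmem j ((show ψ i = t * ψ j from h) ▸ hψA i)).elim
    · exact (hmem i ((show t * ψ i = ψ j from h) ▸ hψA j)).elim
    · exact congrArg sr (hψinj (mul_left_cancel h))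
  · intro g
    by_cases hg : g ∈ A
    · obtain ⟨i, hi⟩ := hψsurj g hg
      exact ⟨r i, hi⟩
    · obtain ⟨i, hi⟩ := hψsurj _ (htmul g hg)
      refine ⟨sr i, ?_⟩
      change t * ψ i = g
      rw [hi, ← mul_assoc, ht2, one_mul]

/-- Recognition of dihedral `2`-groups. If all elements outside `A` are involutions, they invert
`A`, so `A` is abelian and its involutions are central in the group; as the center has order two,
`A` has a single involution and is cyclic. -/
theorem exists_mulEquiv_of_card_center_eq_two {Q : Type*} [Group Q] [Finite Q]
    (hQ : IsPGroup 2 Q) {A : Subgroup Q} (hA : A.index = 2)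
    (hcard : Nat.card (Subgroup.center Q) = 2) (hle : Subgroup.center Q ≤ A)
    (hsq : ∀ g ∉ A, g * g = 1) : ∃ n : ℕ, 2 ≤ n ∧ Nonempty (Q ≃* DihedralGroup (2 ^ n)) := by
  have hmul : ∀ {g h : Q}, g ∉ A → h ∈ A → g * h ∉ A := fun hg hh h ↦
    hg ((A.mul_mem_cancel_right hh).mp h)
  have hinv : ∀ g ∉ A, ∀ k ∈ A, g * k * g = k⁻¹ := fun g hg k hk ↦ by
    rw [eq_inv_iff_mul_eq_one, mul_assoc]
    exact hsq _ (hmul hg hk)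
  obtain ⟨t, ht⟩ : ∃ t, t ∉ A := by
    by_contra! h
    rw [(Subgroup.eq_top_iff' A).mpr h, Subgroup.index_top] at hA
    omega
  have hcomm : ∀ k ∈ A, ∀ l ∈ A, k * l = l * k := fun k hk l hl ↦ by
    have h1 := hinv t ht _ (A.mul_mem hl hk)
    rw [mul_inv_rev, ← hinv t ht k hk, ← hinv t ht l hl] at h1
    have h2 : t * (l * k) * t = t * (k * l) * t := by
      rw [h1]
      calc t * k * t * (t * l * t) = t * k * (t * t) * l * t := by group
        _ = t * (k * l) * t := by rw [hsq t ht]; group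
    exact (mul_left_cancel (mul_right_cancel h2)).symm
  let _ : CommGroup A := { (inferInstance : Group A) with
    mul_comm := fun k l ↦ Subtype.ext (hcomm k k.2 l l.2) }
  have hcentral : ∀ k ∈ A, k ^ 2 = 1 → k ∈ Subgroup.center Q := fun k hk hk2 ↦ by
    rw [Subgroup.mem_center_iff]
    intro g
    by_cases hg : g ∈ A
    · exact hcomm g hg k hk
    · have h1 := hinv g hg k hk
      rw [inv_eq_of_mul_eq_one_left (by rwa [← pow_two])] at h1
      nth_rw 2 [← h1]
      rw [mul_assoc, hsq g hg, mul_one]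
  have hcyc : IsCyclic A := by
    refine IsPGroup.isCyclic_of_unique_involution (hQ.to_subgroup A) fun x y hx hy hx1 hy1 ↦ ?_
    by_contra hne
    have hxc := hcentral x x.2 (congrArg Subtype.val hx)
    have hyc := hcentral y y.2 (congrArg Subtype.val hy)
    obtain ⟨u, hu⟩ := (Nat.card_eq_two_iff' (1 : Subgroup.center Q)).mp hcard
    have h1 := hu.2 ⟨x, hxc⟩ fun h ↦ hx1 (Subtype.ext (congrArg (Subgroup.center Q).subtype h))
    have h2 := hu.2 ⟨y, hyc⟩ fun h ↦ hy1 (Subtype.ext (congrArg (Subgroup.center Q).subtype h))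
    exact hne (Subtype.ext (congrArg (Subgroup.center Q).subtype (h1.trans h2.symm)))
  obtain ⟨n, hn⟩ := IsPGroup.iff_card.mp (hQ.to_subgroup A)
  refine ⟨n, ?_, ?_⟩
  · -- if `A` had order at most two, it would be the center, and `t` would be central
    by_contra hlt
    have hAc : Subgroup.center Q = A := by
      refine Subgroup.eq_of_le_of_card_ge hle ?_
      rw [hcard, hn]
      exact (Nat.pow_le_pow_right two_pos (show n ≤ 1 by omega)).trans (by norm_num)
    refine ht (hle (Subgroup.mem_center_iff.mpr fun g ↦ ?_))
    by_cases hg : g ∈ A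
    · rw [← hAc] at hg
      exact (Subgroup.mem_center_iff.mp hg t).symm
    · have h1 : t * g ∈ Subgroup.center Q :=
        hAc ▸ (Subgroup.mul_mem_iff_of_index_two hA).mpr (iff_of_false ht hg)
      have h2 := Subgroup.mem_center_iff.mp h1 t
      rw [mul_assoc t g t] at h2
      exact (mul_left_cancel h2).symm
  · have e := zmodCyclicMulEquiv hcyc
    rw [hn] at e
    exact nonempty_mulEquiv_of_inverting_involution hA e ht (hsq t ht) (hinv t ht)

end DihedralGroup

/-! ### Sums over a finite group, and a trace lemma -/

section Sums

open ComplexConjugate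

variable {G : Type*} [Group G]

theorem norm_monoidHom_apply_eq_one [Finite G] (ν : G →* ℂ) (g : G) : ‖ν g‖ = 1 :=
  Complex.norm_eq_one_of_pow_eq_one (n := Nat.card G) (by rw [← map_pow, pow_card_eq_one', map_one])
    Nat.card_pos.ne'

theorem mul_conj_monoidHom_apply [Finite G] (ν : G →* ℂ) (g : G) : ν g * conj (ν g) = 1 := by
  rw [Complex.mul_conj', norm_monoidHom_apply_eq_one]
  simp

theorem eq_one_of_norm_eq_one_of_one_le_re {c : ℂ} (hc : ‖c‖ = 1) (hre : 1 ≤ c.re) : c = 1 := by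
  have h1 : c.re * c.re + c.im * c.im = 1 := by
    rw [← Complex.normSq_apply, Complex.normSq_eq_norm_sq, hc, one_pow]
  have h2 : c.im = 0 := by nlinarith [mul_self_nonneg c.im]
  have h3 : c.re = 1 := by nlinarith
  exact Complex.ext h3 h2

theorem sum_monoidHom_eq_zero_or_card [Fintype G] (ν : G →* ℂ) :
    ∃ ε : ℕ, ∑ g, ν g = ε * Nat.card G := by
  by_cases h : ν = 1
  · exact ⟨1, by simp [h]⟩
  · exact ⟨0, by rw [sum_hom_units_eq_zero ν h]; simp⟩

theorem sum_conj_monoidHom_eq_zero [Fintype G] {ν : G →* ℂ} (hν : ν ≠ 1) :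
    ∑ g, conj (ν g) = 0 := by
  rw [← map_sum, sum_hom_units_eq_zero ν hν, map_zero]

theorem sum_eq_zero_of_translate_eq_neg [Fintype G] {φ : G → ℂ} (z : G)
    (h : ∀ g, φ (z * g) = -φ g) : ∑ g, φ g = 0 := by
  have h1 : ∑ g, φ g = -∑ g, φ g := by
    conv_lhs => rw [← Equiv.sum_comp (Equiv.mulLeft z) φ]
    simp [h]
  exact self_eq_neg.mp h1

/-- A combination `1 + a μ₁ + b μ₂` of linear characters, trivial on `K` and vanishing off `K`, is a
multiple of the regular character of the quotient by `K`, in which all linear characters have equal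
multiplicity. If `μ₁` and `μ₂` were both nontrivial, then `a = b = 1`, and the degree `3` would not
be a square. -/
theorem eq_one_or_eq_one_of_vanishing_off [Finite G] {K : Subgroup G} {μ₁ μ₂ : G →* ℂ}
    (h₁ : ∀ k ∈ K, μ₁ k = 1) (h₂ : ∀ k ∈ K, μ₂ k = 1) {a b d : ℕ} (ha : 0 < a) (hb : 0 < b)
    (hd : d ^ 2 = 1 + a + b) (h0 : ∀ g ∉ K, 1 + a * μ₁ g + b * μ₂ g = 0) : μ₁ = 1 ∨ μ₂ = 1 := by
  by_contra! hne
  obtain ⟨hne₁, hne₂⟩ := hne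
  have := Fintype.ofFinite G
  have hN : (Nat.card G : ℂ) ≠ 0 := Nat.cast_ne_zero.mpr Nat.card_pos.ne'
  have hsum : ∑ g, (1 + a * μ₁ g + b * μ₂ g) = Nat.card G := by
    rw [Finset.sum_add_distrib, Finset.sum_add_distrib, ← Finset.mul_sum, ← Finset.mul_sum,
      sum_hom_units_eq_zero μ₁ hne₁, sum_hom_units_eq_zero μ₂ hne₂]
    simp
  -- multiplying by a linear character that is trivial on `K` does not change the sum
  have key : ∀ ν : G →* ℂ, (∀ k ∈ K, ν k = 1) →
      ∑ g, (1 + a * μ₁ g + b * μ₂ g) * conj (ν g) = Nat.card G := fun ν hν ↦ by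
    rw [← hsum]
    refine Finset.sum_congr rfl fun g _ ↦ ?_
    by_cases hg : g ∈ K
    · rw [hν g hg, map_one, mul_one]
    · rw [h0 g hg, zero_mul]
  have hconj : ∀ μ ν : G →* ℂ, ∃ ε : ℕ, ∑ g, μ g * conj (ν g) = ε * Nat.card G := fun μ ν ↦
    sum_monoidHom_eq_zero_or_card (μ * ((starRingEnd ℂ : ℂ →* ℂ).comp ν))
  have ha1 : a = 1 := by
    obtain ⟨ε, hε⟩ := hconj μ₂ μ₁
    have h := key μ₁ h₁
    simp only [add_mul, one_mul, mul_assoc, mul_conj_monoidHom_apply] at h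
    rw [Finset.sum_add_distrib, Finset.sum_add_distrib, ← Finset.mul_sum, ← Finset.mul_sum, hε,
      sum_conj_monoidHom_eq_zero hne₁] at h
    have h3 : (a + b * ε : ℂ) = 1 := mul_right_cancel₀ hN (by simpa [add_mul, mul_assoc] using h)
    have h4 : a + b * ε = 1 := by exact_mod_cast h3
    omega
  have hb1 : b = 1 := by
    obtain ⟨ε, hε⟩ := hconj μ₁ μ₂
    have h := key μ₂ h₂
    simp only [add_mul, one_mul, mul_assoc, mul_conj_monoidHom_apply] at h
    rw [Finset.sum_add_distrib, Finset.sum_add_distrib, ← Finset.mul_sum, ← Finset.mul_sum, hε,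
      sum_conj_monoidHom_eq_zero hne₂] at h
    have h3 : (a * ε + b : ℂ) = 1 := mul_right_cancel₀ hN (by simpa [add_mul, mul_assoc] using h)
    have h4 : a * ε + b = 1 := by exact_mod_cast h3
    omega
  subst ha1 hb1
  rcases Nat.lt_or_ge d 2 with h | h <;> nlinarith

/-- If `1 + a + b * c = 0` with `a, b` natural numbers and `c` on the unit circle, then `c = -1`. -/
theorem eq_of_one_add_add_mul_eq_zero {a b : ℕ} {c : ℂ} (hc : ‖c‖ = 1)
    (h : (1 + a + b * c : ℂ) = 0) : b = 1 + a ∧ c = -1 := by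
  have h1 : (b : ℂ) * c = -((1 + a : ℕ) : ℂ) := by push_cast; linear_combination h
  have h2 : b = 1 + a := by
    have := congrArg norm h1
    rw [norm_mul, norm_neg, hc, mul_one, Complex.norm_natCast, Complex.norm_natCast] at this
    exact_mod_cast this
  refine ⟨h2, mul_left_cancel₀ (Nat.cast_ne_zero.mpr (by omega : b ≠ 0)) ?_⟩
  rw [h1, h2]
  ring

/-- A nonnegative weight on a finite group with total mass `M` has Fourier coefficients at most `M`
at linear characters `ν`, with equality only if it is supported on the kernel of `ν`. -/
theorem fourierCoeff_le_of_nonneg [Fintype G] {w : G → ℝ} (hw : ∀ g, 0 ≤ w g) (ν : G →* ℂ)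
    {M m : ℝ} (hM : ∑ g, w g = M) (hm : ∑ g, (w g : ℂ) * conj (ν g) = m) :
    m ≤ M ∧ (m = M → ∀ g, ν g ≠ 1 → w g = 0) := by
  have hre : ∀ g, (ν g).re ≤ 1 := fun g ↦
    (Complex.re_le_norm _).trans (norm_monoidHom_apply_eq_one ν g).le
  have hnn : ∀ g ∈ Finset.univ, 0 ≤ w g * (1 - (ν g).re) := fun g _ ↦
    mul_nonneg (hw g) (sub_nonneg.mpr (hre g))
  have hsum : ∑ g, w g * (1 - (ν g).re) = M - m := by
    have h1 := congrArg Complex.re hm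
    rw [Complex.re_sum] at h1
    simp only [Complex.re_ofReal_mul, Complex.conj_re, Complex.ofReal_re] at h1
    simp only [mul_sub, mul_one]
    rw [Finset.sum_sub_distrib, h1, hM]
  refine ⟨sub_nonneg.mp (hsum ▸ Finset.sum_nonneg hnn), fun hmM g hg ↦ ?_⟩
  rw [hmM, sub_self, Finset.sum_eq_zero_iff_of_nonneg hnn] at hsum
  refine (mul_eq_zero.mp (hsum g (Finset.mem_univ g))).resolve_right fun h ↦ hg ?_
  exact eq_one_of_norm_eq_one_of_one_le_re (norm_monoidHom_apply_eq_one ν g) (by linarith)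

end Sums

/-- By Cayley-Hamilton, a `2 × 2` matrix of trace zero has a scalar square. -/
theorem exists_mul_self_eq_algebraMap_of_trace_eq_zero {T : Module.End ℂ (Fin 2 → ℂ)}
    (h : LinearMap.trace ℂ _ T = 0) :
    ∃ c : ℂ, T * T = algebraMap ℂ (Module.End ℂ (Fin 2 → ℂ)) c := by
  refine ⟨-LinearMap.det T, ?_⟩
  have h1 := LinearMap.aeval_self_charpoly T
  rw [← LinearMap.charpoly_toMatrix T (Pi.basisFun ℂ (Fin 2)), Matrix.charpoly_fin_two,
    ← LinearMap.trace_eq_matrix_trace, h, LinearMap.det_toMatrix] at h1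
  simp only [map_add, map_pow, Polynomial.aeval_X, Polynomial.aeval_C, map_zero,
    zero_mul, sub_zero] at h1
  rw [← pow_two, map_neg]
  exact eq_neg_of_add_eq_zero_left h1

/-! ### Restriction to the second center -/

open ComplexConjugate

/-- The second center: the preimage in `G` of the center of `G ⧸ Z(G)`. -/
def secondCenter (G : Type*) [Group G] : Subgroup G :=
  (Subgroup.center (G ⧸ Subgroup.center G)).comap (QuotientGroup.mk' _)

theorem mem_secondCenter {G : Type*} [Group G] {z : G} :
    z ∈ secondCenter G ↔ (z : G ⧸ Subgroup.center G) ∈ Subgroup.center (G ⧸ Subgroup.center G) :=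
  Iff.rfl

theorem commutator_mem_center_of_mem_secondCenter {G : Type*} [Group G] {z : G}
    (hz : z ∈ secondCenter G) (g : G) : g * z * g⁻¹ * z⁻¹ ∈ Subgroup.center G := by
  rw [← QuotientGroup.eq_one_iff]
  simp only [QuotientGroup.mk_mul, QuotientGroup.mk_inv]
  rw [Subgroup.mem_center_iff.mp (mem_secondCenter.mp hz), mul_inv_cancel_right, mul_inv_cancel]

namespace Representation

variable {G V : Type*} [Group G] [AddCommGroup V] [Module ℂ V] [FiniteDimensional ℂ V]

theorem center_le_scalarSubgroup {ρ : Representation ℂ G V} (hρ : ρ.IsIrreducible) :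
    Subgroup.center G ≤ ρ.scalarSubgroup := fun _ hz ↦
  mem_scalarSubgroup_of_commute hρ fun g ↦ by rw [Subgroup.mem_center_iff.mp hz g]

omit [FiniteDimensional ℂ V] in
theorem scalarSubgroup_le_center {ρ : Representation ℂ G V} (hinj : ∀ g, ρ g = 1 → g = 1) :
    ρ.scalarSubgroup ≤ Subgroup.center G := by
  rintro z ⟨c, hc⟩
  rw [Subgroup.mem_center_iff]
  intro g
  have h1 : g * z * (z * g)⁻¹ = 1 := hinj _ <| by
    rw [map_mul, map_mul, hc, ← Algebra.commutes, ← hc, ← map_mul, ← map_mul, mul_inv_cancel,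
      map_one]
  exact mul_inv_eq_one.mp h1

omit [FiniteDimensional ℂ V] in
theorem exists_monoidHom_eq_character {ρ : Representation ℂ G V} (h : Module.finrank ℂ V = 1) :
    ∃ ν : G →* ℂ, ∀ g, ρ.character g = ν g := by
  have := Module.finite_of_finrank_pos (h ▸ one_pos)
  have := Module.nontrivial_of_finrank_pos (h ▸ one_pos)
  obtain ⟨μ, hμ⟩ := exists_hom_of_le_scalarSubgroup (ρ := ρ) (H := ⊤) fun g _ ↦ by
    obtain ⟨c, hc, -⟩ := LinearMap.existsUnique_eq_smul_id_of_finrank_eq_one h (ρ g)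
    exact ⟨c, hc⟩
  refine ⟨μ.comp Subgroup.topEquiv.symm.toMonoidHom, fun g ↦ ?_⟩
  rw [character_of_eq_algebraMap (hμ ⟨g, Subgroup.mem_top g⟩), h, Nat.cast_one, mul_one]
  rfl

/-- An irreducible representation that is trivial on the center is scalar on the second center. -/
theorem secondCenter_le_scalarSubgroup {ρ : Representation ℂ G V} (hρ : ρ.IsIrreducible)
    (hZ : ∀ z ∈ Subgroup.center G, ρ z = 1) : secondCenter G ≤ ρ.scalarSubgroup := fun z hz ↦
  mem_scalarSubgroup_of_commute hρ fun g ↦ by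
    rw [← one_mul (ρ (z * g)), ← hZ _ (commutator_mem_center_of_mem_secondCenter hz g), ← map_mul]
    congr 1
    group

end Representation

open Representation

theorem exists_mem_secondCenter_notMem_center {G : Type*} [Group G] [Group.IsNilpotent G]
    (h : Subgroup.center G ≠ ⊤) : ∃ z ∈ secondCenter G, z ∉ Subgroup.center G := by
  have hnt : Nontrivial (G ⧸ Subgroup.center G) := by
    rw [← not_subsingleton_iff_nontrivial]
    exact fun hs ↦ h (QuotientGroup.subgroup_eq_top_of_subsingleton _ hs)
  obtain ⟨⟨x, hxc⟩, hx1⟩ := Subgroup.ne_bot_iff_exists_ne_one.mp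
    (Group.IsNilpotent.center_ne_bot (G := G ⧸ Subgroup.center G))
  obtain ⟨z, rfl⟩ := QuotientGroup.mk_surjective x
  exact ⟨z, hxc, fun hz ↦ hx1 (Subtype.ext ((QuotientGroup.eq_one_iff z).mpr hz))⟩

/-- If a representation is `-1` on the second center outside the center, then two such elements
cannot differ by a third one, so `G ⧸ Z(G)` has a center of order two. -/
theorem card_center_quotient_eq_two {G V : Type*} [Group G] [AddCommGroup V] [Module ℂ V]
    [Nontrivial V] {ρ : Representation ℂ G V}
    (hneg : ∀ z ∈ secondCenter G, z ∉ Subgroup.center G → ρ z = -1)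
    {z₀ : G} (hz₀ : z₀ ∈ secondCenter G) (hz₀Z : z₀ ∉ Subgroup.center G) :
    Nat.card (Subgroup.center (G ⧸ Subgroup.center G)) = 2 := by
  rw [Nat.card_eq_two_iff' 1]
  refine ⟨⟨z₀, hz₀⟩, fun h ↦ hz₀Z ?_, ?_⟩
  · exact (QuotientGroup.eq_one_iff z₀).mp (congrArg (Subgroup.center _).subtype h)
  · rintro ⟨x, hx⟩ hx1
    obtain ⟨z, rfl⟩ := QuotientGroup.mk_surjective x
    have hzZ : z ∉ Subgroup.center G := fun h ↦
      hx1 (Subtype.ext ((QuotientGroup.eq_one_iff z).mpr h))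
    refine Subtype.ext (QuotientGroup.eq.mpr ?_)
    by_contra hne
    have h1 := hneg _ ((secondCenter G).mul_mem ((secondCenter G).inv_mem hx) hz₀) hne
    have h2 : ρ z * ρ (z⁻¹ * z₀) = ρ z₀ := by rw [← map_mul, mul_inv_cancel_left]
    rw [h1, hneg z hx hzZ, hneg z₀ hz₀ hz₀Z, neg_mul_neg, one_mul] at h2
    -- `1 = -1` fails for operators on a nontrivial complex vector space
    obtain ⟨v, hv⟩ := exists_ne (0 : V)
    have h3 : v = -v := by simpa using LinearMap.congr_fun h2 v
    have h4 : (2 : ℂ) • v = 0 := by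
      rw [two_smul]
      exact eq_neg_iff_add_eq_zero.mp h3
    exact hv ((smul_eq_zero.mp h4).resolve_left two_ne_zero)

/-! ### Constituents and the quotient by the center -/

/-- The case of the theorem in which `α₁` is trivial on the second center and `α₂` restricts to it
as a multiple of the character of order two. -/
theorem dihedral_of_decomposition {G V₁ V₂ : Type*} [Group G] [Finite G] [Group.IsNilpotent G]
    {n : ℕ} [AddCommGroup V₁] [Module ℂ V₁] [FiniteDimensional ℂ V₁]
    [AddCommGroup V₂] [Module ℂ V₂] [FiniteDimensional ℂ V₂]
    {ρ : Representation ℂ G (Fin n → ℂ)} {ρ₁ : Representation ℂ G V₁} {ρ₂ : Representation ℂ G V₂}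
    (hinj : ∀ g, ρ g = 1 → g = 1)
    (hρ₁ : ρ₁.IsIrreducible) (hρ₂ : ρ₂.IsIrreducible) (hne : ρ₁.character ≠ 1)
    {m₁ m₂ : ℕ} (hm₁ : 0 < m₁)
    (hdecomp : ∀ g, ρ.character g * conj (ρ.character g) =
      1 + m₁ * ρ₁.character g + m₂ * ρ₂.character g)
    (hH₁ : ∀ z ∈ secondCenter G, ρ₁ z = 1)
    (hneg : ∀ z ∈ secondCenter G, z ∉ Subgroup.center G → ρ₂ z = -1)
    (hdeg : m₂ * Module.finrank ℂ V₂ = 1 + m₁ * Module.finrank ℂ V₁)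
    {z₀ : G} (hz₀ : z₀ ∈ secondCenter G) (hz₀Z : z₀ ∉ Subgroup.center G) :
    m₁ = 1 ∧ m₂ = 1 ∧ n = 2 ∧
      ∃ k : ℕ, 2 ≤ k ∧ Nonempty ((G ⧸ Subgroup.center G) ≃* DihedralGroup (2 ^ k)) := by
  classical
  have := Fintype.ofFinite G
  have := hρ₁.nontrivial_space
  have := hρ₂.nontrivial_space
  have hcard := card_center_quotient_eq_two hneg hz₀ hz₀Z
  have hQ : IsPGroup 2 (G ⧸ Subgroup.center G) :=
    Group.isPGroup_of_isPGroup_center (IsPGroup.of_card (n := 1) (by rw [hcard, pow_one]))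
  -- the degree of `ρ₁` is odd
  have hn2 : n * n = 2 * (m₂ * Module.finrank ℂ V₂) := by
    have h := hdecomp 1
    simp only [char_one, Module.finrank_fin_fun, map_natCast] at h
    have h' : n * n = 1 + m₁ * Module.finrank ℂ V₁ + m₂ * Module.finrank ℂ V₂ := by
      exact_mod_cast h
    omega
  have hodd : Odd (Module.finrank ℂ V₁) := by
    obtain ⟨e, rfl⟩ : 2 ∣ n := (Nat.prime_two.dvd_mul.mp ⟨_, hn2⟩).elim id id
    have h1 : Odd (m₁ * Module.finrank ℂ V₁) := by
      rw [Nat.odd_iff]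
      have : m₂ * Module.finrank ℂ V₂ = 2 * (e * e) := by nlinarith
      omega
    exact (Nat.odd_mul.mp h1).2
  -- hence `ρ₁` is linear
  have htop : ρ₁.scalarSubgroup = ⊤ := by
    refine scalarSubgroup_eq_top_of_odd_finrank hρ₁ (fun g ↦ ?_) hodd
    obtain ⟨k, hk⟩ := hQ g
    rw [← QuotientGroup.mk_pow, QuotientGroup.eq_one_iff] at hk
    exact ⟨k, center_le_scalarSubgroup hρ₁ hk⟩
  have hn₁ := finrank_eq_one_of_scalarSubgroup_eq_top hρ₁ htop
  obtain ⟨ν, hν⟩ := exists_monoidHom_eq_character (ρ := ρ₁) hn₁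
  have hν1 : ν ≠ 1 := by
    rintro rfl
    exact hne (funext hν)
  have hνH : ∀ z ∈ secondCenter G, ν z = 1 := fun z hz ↦ by
    rw [← hν, character, hH₁ z hz, LinearMap.trace_one, hn₁, Nat.cast_one]
  have hchar₂ : ∀ g, ρ₂.character (z₀ * g) = -ρ₂.character g := fun g ↦ by
    rw [character, map_mul, hneg z₀ hz₀ hz₀Z, neg_mul, one_mul, map_neg, character]
  rw [hn₁, mul_one] at hdeg
  -- the weight `|χ| ^ 2`, whose Fourier coefficients at linear characters are computed below
  let w : G → ℝ := fun g ↦ Complex.normSq (ρ.character g)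
  have hw : ∀ g, 0 ≤ w g := fun g ↦ Complex.normSq_nonneg _
  have hwd : ∀ g, (w g : ℂ) = 1 + m₁ * ν g + m₂ * ρ₂.character g := fun g ↦ by
    rw [← hν, ← hdecomp, Complex.mul_conj]
  have hM : ∑ g, w g = Nat.card G := by
    have h : ((∑ g, w g : ℝ) : ℂ) = Nat.card G := by
      push_cast
      simp only [hwd]
      rw [Finset.sum_add_distrib, Finset.sum_add_distrib, ← Finset.mul_sum, ← Finset.mul_sum,
        sum_hom_units_eq_zero ν hν1, sum_eq_zero_of_translate_eq_neg z₀ hchar₂]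
      simp
    exact_mod_cast h
  have hcoeff₁ : ∑ g, (w g : ℂ) * conj (ν g) = ((m₁ * Nat.card G : ℝ) : ℂ) := by
    simp only [hwd, add_mul, one_mul, mul_assoc, mul_conj_monoidHom_apply]
    rw [Finset.sum_add_distrib, Finset.sum_add_distrib, ← Finset.mul_sum, ← Finset.mul_sum,
      sum_conj_monoidHom_eq_zero hν1,
      sum_eq_zero_of_translate_eq_neg (φ := fun g ↦ ρ₂.character g * conj (ν g)) z₀]
    · simp
    · intro g
      rw [hchar₂, map_mul, hνH z₀ hz₀, one_mul, neg_mul]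
  have hNR : (0 : ℝ) < Nat.card G := Nat.cast_pos.mpr Nat.card_pos
  obtain ⟨hle₁, hsupp⟩ := fourierCoeff_le_of_nonneg hw ν hM hcoeff₁
  have hm₁1 : m₁ = 1 := by
    have : (m₁ : ℝ) ≤ 1 := le_of_mul_le_mul_right (by simpa using hle₁) hNR
    have : m₁ ≤ 1 := by exact_mod_cast this
    omega
  subst hm₁1
  have hvanish : ∀ g, ν g ≠ 1 → ρ.character g = 0 := fun g hg ↦
    Complex.normSq_eq_zero.mp (hsupp (by simp) g hg)
  obtain rfl : n = 2 := by
    rw [hdeg] at hn2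
    nlinarith
  -- `ρ₂` is not linear, since otherwise the multiplicity `m₂ = 2` would exceed one
  have hm₂1 : m₂ = 1 := by
    by_contra hm₂
    have hn₂ : m₂ = 2 ∧ Module.finrank ℂ V₂ = 1 := by
      have h1 : m₂ ∣ 2 := ⟨_, hdeg.symm⟩
      have h2 : m₂ = 2 := ((Nat.dvd_prime Nat.prime_two).mp h1).resolve_left hm₂
      rw [h2] at hdeg
      omega
    obtain ⟨hm₂2, hn₂⟩ := hn₂
    obtain ⟨η, hη⟩ := exists_monoidHom_eq_character (ρ := ρ₂) hn₂
    have hηz : η z₀ = -1 := by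
      have h := hchar₂ 1
      rwa [mul_one, hη, hη, map_one] at h
    have hcoeff₂ : ∑ g, (w g : ℂ) * conj (η g) = ((m₂ * Nat.card G : ℝ) : ℂ) := by
      simp only [hwd, hη, add_mul, one_mul, mul_assoc, mul_conj_monoidHom_apply]
      rw [Finset.sum_add_distrib, Finset.sum_add_distrib, ← Finset.mul_sum, ← Finset.mul_sum,
        sum_eq_zero_of_translate_eq_neg (φ := fun g ↦ conj (η g)) z₀,
        sum_eq_zero_of_translate_eq_neg (φ := fun g ↦ ν g * conj (η g)) z₀]
      · simp
      · intro g
        rw [map_mul, map_mul, hνH z₀ hz₀, hηz]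
        simp
      · intro g
        rw [map_mul, hηz]
        simp
    have hle := (fourierCoeff_le_of_nonneg hw η hM hcoeff₂).1
    rw [hm₂2] at hle
    push_cast at hle
    linarith
  refine ⟨rfl, hm₂1, rfl, ?_⟩
  subst hm₂1
  -- the kernel of `ν` has index two: `|χ| ^ 2 = 2 + α₂` on it, and `|χ| ^ 2` vanishes outside
  let K : Subgroup G := ν.ker
  have hHK : secondCenter G ≤ K := fun z hz ↦ hνH z hz
  have hZH : Subgroup.center G ≤ secondCenter G := fun z hz ↦ by
    rw [mem_secondCenter, (QuotientGroup.eq_one_iff z).mpr hz]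
    exact Subgroup.one_mem _
  have hKindex : K.index = 2 := by
    have h1 : ∀ g, (w g : ℂ) = (if g ∈ K then 2 else 0) + if g ∈ K then ρ₂.character g else 0 := by
      intro g
      by_cases hg : g ∈ K
      · rw [if_pos hg, if_pos hg, hwd, show ν g = 1 from hg]
        push_cast
        ring
      · rw [if_neg hg, if_neg hg]
        simp [w, hvanish g hg]
    have h2 : (∑ g, (w g : ℂ)) = Nat.card G := by exact_mod_cast congrArg Complex.ofReal hM
    have h3 : ∑ g, (if g ∈ K then ρ₂.character g else 0) = 0 :=
      sum_eq_zero_of_translate_eq_neg z₀ fun g ↦ by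
        simp only [K.mul_mem_cancel_left (hHK hz₀), hchar₂]
        split_ifs <;> simp
    simp only [h1] at h2
    rw [Finset.sum_add_distrib, h3, add_zero, ← Finset.sum_filter, Finset.sum_const,
      nsmul_eq_mul] at h2
    have h4 : (Finset.univ.filter (· ∈ K)).card = Nat.card K := by
      rw [Nat.card_eq_fintype_card, Fintype.card_subtype]
    rw [h4, ← K.card_mul_index] at h2
    have h5 : Nat.card K * 2 = Nat.card K * K.index := by exact_mod_cast h2
    exact (Nat.eq_of_mul_eq_mul_left Nat.card_pos h5).symm
  have hsq : ∀ g ∉ K, g * g ∈ Subgroup.center G := fun g hg ↦ by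
    obtain ⟨c, hc⟩ := exists_mul_self_eq_algebraMap_of_trace_eq_zero (hvanish g hg)
    exact scalarSubgroup_le_center hinj ⟨c, by rw [map_mul, hc]⟩
  have hmem : ∀ g : G, (g : G ⧸ Subgroup.center G) ∈ K.map (QuotientGroup.mk' _) ↔ g ∈ K := by
    refine fun g ↦ ⟨?_, fun hg ↦ Subgroup.mem_map_of_mem _ hg⟩
    rintro ⟨k, hk, hkg⟩
    have h := hHK (hZH (QuotientGroup.eq.mp hkg))
    exact (K.mul_mem_cancel_left (K.inv_mem hk)).mp h
  refine DihedralGroup.exists_mulEquiv_of_card_center_eq_two hQ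
    (A := K.map (QuotientGroup.mk' _)) ?_ hcard ?_ ?_
  · rw [Subgroup.index_map_eq K (QuotientGroup.mk'_surjective _), hKindex]
    rw [QuotientGroup.ker_mk']
    exact hZH.trans hHK
  · intro x hx
    obtain ⟨z, rfl⟩ := QuotientGroup.mk_surjective x
    exact (hmem z).mpr (hHK hx)
  · intro x hx
    obtain ⟨g, rfl⟩ := QuotientGroup.mk_surjective x
    rw [hmem] at hx
    exact (QuotientGroup.eq_one_iff _).mpr (hsq g hx)

theorem mainTheorem7 {G : Type*} [Group G] [Finite G] [Group.IsNilpotent G]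
    (χ α₁ α₂ : G → ℂ) (m₁ m₂ : ℕ)
    (hχ : IsIrrChar χ) (hfaithful : IsFaithfulChar χ)
    (hα₁ : IsIrrChar α₁) (hα₂ : IsIrrChar α₂)
    (hα₁_ne : α₁ ≠ 1) (hα₂_ne : α₂ ≠ 1)
    (hm₁ : 0 < m₁) (hm₂ : 0 < m₂)
    (hdecomp : ∀ g : G,
      χ g * (starRingEnd ℂ) (χ g) = 1 + (m₁ : ℂ) * α₁ g + (m₂ : ℂ) * α₂ g) :
    m₁ = 1 ∧ m₂ = 1 ∧ χ 1 = 2 ∧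
      ∃ n : ℕ, 2 ≤ n ∧ Nonempty ((G ⧸ Subgroup.center G) ≃* DihedralGroup (2 ^ n)) := by
  obtain ⟨n, ρ, hρ, rfl⟩ := hχ
  obtain ⟨n₁, ρ₁, hρ₁, rfl⟩ := hα₁
  obtain ⟨n₂, ρ₂, hρ₂, rfl⟩ := hα₂
  have := hρ.nontrivial_space
  have := hρ₁.nontrivial_space
  have := hρ₂.nontrivial_space
  have hpos : ∀ k : ℕ, Nontrivial (Fin k → ℂ) → 0 < k := fun k hk ↦ by
    simpa using Module.finrank_pos (R := ℂ) (M := Fin k → ℂ)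
  have ha : 0 < m₁ * n₁ := Nat.mul_pos hm₁ (hpos n₁ ‹_›)
  have hb : 0 < m₂ * n₂ := Nat.mul_pos hm₂ (hpos n₂ ‹_›)
  have hinj : ∀ g, ρ g = 1 → g = 1 := fun g hg ↦ by
    have h : g ∈ charKer ρ.character := by
      change ρ.character g = ρ.character 1
      rw [character, character, hg, map_one ρ]
    rw [hfaithful] at h
    exact h
  have hscal : ρ.scalarSubgroup = Subgroup.center G :=
    le_antisymm (scalarSubgroup_le_center hinj) (center_le_scalarSubgroup hρ)
  have hd : n ^ 2 = 1 + m₁ * n₁ + m₂ * n₂ := by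
    have h := hdecomp 1
    simp only [char_one, Module.finrank_fin_fun, map_natCast] at h
    rw [pow_two]
    exact_mod_cast h
  obtain ⟨z₀, hz₀, hz₀Z⟩ : ∃ z ∈ secondCenter G, z ∉ Subgroup.center G := by
    refine exists_mem_secondCenter_notMem_center fun htop ↦ ?_
    have h := finrank_eq_one_of_scalarSubgroup_eq_top hρ (hscal.trans htop)
    rw [Module.finrank_fin_fun] at h
    rw [h] at hd
    omega
  -- on the center `|χ| = χ 1`, so the constituents `α₁` and `α₂` are trivial there
  have hZ : ∀ z ∈ Subgroup.center G, ρ₁ z = 1 ∧ ρ₂ z = 1 := fun z hz ↦ by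
    obtain ⟨μ, hμ⟩ := exists_hom_of_le_scalarSubgroup (center_le_scalarSubgroup hρ)
    obtain ⟨μ₁, hμ₁⟩ := exists_hom_of_le_scalarSubgroup (center_le_scalarSubgroup hρ₁)
    obtain ⟨μ₂, hμ₂⟩ := exists_hom_of_le_scalarSubgroup (center_le_scalarSubgroup hρ₂)
    lift z to Subgroup.center G using hz
    have h := hdecomp z
    rw [character_of_eq_algebraMap (hμ z), character_of_eq_algebraMap (hμ₁ z),
      character_of_eq_algebraMap (hμ₂ z)] at h
    simp only [Module.finrank_fin_fun, map_mul, map_natCast] at h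
    have h1 : (1 + m₁ * n₁ + m₂ * n₂ : ℂ) = 1 + m₁ * n₁ * μ₁ z + m₂ * n₂ * μ₂ z := by
      have hd' : (n ^ 2 : ℂ) = 1 + m₁ * n₁ + m₂ * n₂ := by exact_mod_cast hd
      rw [← hd']
      linear_combination h - (n ^ 2 : ℂ) * mul_conj_monoidHom_apply μ z
    have h2 : (1 + (m₁ * n₁ : ℕ) + (m₂ * n₂ : ℕ) : ℝ) =
        1 + (m₁ * n₁ : ℕ) * (μ₁ z).re + (m₂ * n₂ : ℕ) * (μ₂ z).re := by
      have h3 := congrArg Complex.re h1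
      norm_cast at h3
      simpa [← Nat.cast_mul, -Nat.cast_mul] using h3
    have hre₁ := (Complex.re_le_norm _).trans (norm_monoidHom_apply_eq_one μ₁ z).le
    have hre₂ := (Complex.re_le_norm _).trans (norm_monoidHom_apply_eq_one μ₂ z).le
    have ha' : (0 : ℝ) < (m₁ * n₁ : ℕ) := Nat.cast_pos.mpr ha
    have hb' : (0 : ℝ) < (m₂ * n₂ : ℕ) := Nat.cast_pos.mpr hb
    rw [hμ₁, hμ₂, eq_one_of_norm_eq_one_of_one_le_re (norm_monoidHom_apply_eq_one μ₁ z)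
      (by nlinarith), eq_one_of_norm_eq_one_of_one_le_re (norm_monoidHom_apply_eq_one μ₂ z)
      (by nlinarith), map_one, map_one]
    exact ⟨rfl, rfl⟩
  obtain ⟨μ₁, hμ₁⟩ := exists_hom_of_le_scalarSubgroup
    (secondCenter_le_scalarSubgroup hρ₁ fun z hz ↦ (hZ z hz).1)
  obtain ⟨μ₂, hμ₂⟩ := exists_hom_of_le_scalarSubgroup
    (secondCenter_le_scalarSubgroup hρ₂ fun z hz ↦ (hZ z hz).2)
  have htriv : ∀ {k : ℕ} [Nontrivial (Fin k → ℂ)] {σ : Representation ℂ G (Fin k → ℂ)}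
      {μ : secondCenter G →* ℂ} {h : secondCenter G},
      σ h = algebraMap ℂ (Module.End ℂ (Fin k → ℂ)) (μ h) → σ h = 1 → μ h = 1 :=
    fun hμ h1 ↦ FaithfulSMul.algebraMap_injective ℂ (Module.End ℂ _) (by rw [← hμ, h1, map_one])
  -- off the center `χ` vanishes on the second center
  have h0 : ∀ h : secondCenter G, h ∉ (Subgroup.center G).subgroupOf (secondCenter G) →
      1 + (m₁ * n₁ : ℕ) * μ₁ h + (m₂ * n₂ : ℕ) * μ₂ h = 0 := fun h hh ↦ by
    have hchar : ρ.character h = 0 := character_eq_zero_of_commutator_mem hρ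
      (by rwa [hscal]) fun g ↦ by
        rw [hscal]
        exact commutator_mem_center_of_mem_secondCenter h.2 g
    have h1 := hdecomp h
    rw [hchar, character_of_eq_algebraMap (hμ₁ h), character_of_eq_algebraMap (hμ₂ h)] at h1
    simp only [Module.finrank_fin_fun, zero_mul] at h1
    push_cast
    linear_combination -h1
  have hχ2 : n = 2 → ρ.character 1 = 2 := fun h ↦ by
    rw [char_one, Module.finrank_fin_fun, h, Nat.cast_ofNat]
  rcases eq_one_or_eq_one_of_vanishing_off
    (fun h hh ↦ htriv (hμ₁ h) (hZ h hh).1) (fun h hh ↦ htriv (hμ₂ h) (hZ h hh).2) ha hb hd h0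
    with hμ1 | hμ1
  · have hoff : ∀ h : secondCenter G, (h : G) ∉ Subgroup.center G →
        m₂ * n₂ = 1 + m₁ * n₁ ∧ μ₂ h = -1 := fun h hh ↦ by
      have h1 := h0 h hh
      rw [hμ1, MonoidHom.one_apply, mul_one] at h1
      exact eq_of_one_add_add_mul_eq_zero (norm_monoidHom_apply_eq_one μ₂ h) h1
    obtain ⟨r₁, r₂, r₃, r₄⟩ := dihedral_of_decomposition hinj hρ₁ hρ₂ hα₁_ne hm₁ hdecomp
      (fun z hz ↦ by rw [hμ₁ ⟨z, hz⟩, hμ1, MonoidHom.one_apply, map_one])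
      (fun z hz hzZ ↦ by rw [hμ₂ ⟨z, hz⟩, (hoff ⟨z, hz⟩ hzZ).2, map_neg, map_one])
      (by simpa using (hoff ⟨z₀, hz₀⟩ hz₀Z).1) hz₀ hz₀Z
    exact ⟨r₁, r₂, hχ2 r₃, r₄⟩
  · have hoff : ∀ h : secondCenter G, (h : G) ∉ Subgroup.center G →
        m₁ * n₁ = 1 + m₂ * n₂ ∧ μ₁ h = -1 := fun h hh ↦ by
      have h1 := h0 h hh
      rw [hμ1, MonoidHom.one_apply, mul_one, add_right_comm] at h1
      exact eq_of_one_add_add_mul_eq_zero (norm_monoidHom_apply_eq_one μ₁ h) h1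
    obtain ⟨r₁, r₂, r₃, r₄⟩ := dihedral_of_decomposition hinj hρ₂ hρ₁ hα₂_ne hm₂
      (fun g ↦ by rw [hdecomp, add_right_comm])
      (fun z hz ↦ by rw [hμ₂ ⟨z, hz⟩, hμ1, MonoidHom.one_apply, map_one])
      (fun z hz hzZ ↦ by rw [hμ₁ ⟨z, hz⟩, (hoff ⟨z, hz⟩ hzZ).2, map_neg, map_one])
      (by simpa using (hoff ⟨z₀, hz₀⟩ hz₀Z).1) hz₀ hz₀Z
    exact ⟨r₂, r₁, hχ2 r₃, r₄⟩
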